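/- Let $1<p<\infty$, let $n\ge 0$ be an integer, and let $G$ be a group of type $FP_n$ (that is, the trivial $\mathbb Z[G]$-module $\mathbb Z$ has a projective resolution $\dots\to F_1\xrightarrow{\partial_1}F_0\to\mathbb Z\to 0$ over $\mathbb Z[G]$ with $F_0,\dots,F_n$ finitely generated). Let $l^p(G)$ be the Banach space of functions $f:G\to\mathbb C$ with $\sum_{g\in G}|f(g)|^p<\infty$, viewed as a $\mathbb Z[G]$-module by left translation. For every such resolution $F$, the groups $F_i\otimes_{\mathbb Z[G]}l^p(G)$ (with $F_i$ made a right module by $x\cdot g=g^{-1}x$) and $\mathrm{Hom}_{\mathbb Z[G]}(F_i,l^p(G))$, $i\le n$, carry natural topologies: a choice of generators $x_1,\dots,x_k$ of $F_i$ makes $F_i\otimes_{\mathbb Z[G]}l^p(G)$ a topological quotient of $l^p(G)^k$ via $(f_j)\mapsto\sum_j x_j\otimes f_j$, and $\mathrm{Hom}_{\mathbb Z[G]}(F_i,l^p(G))$ a topological subspace of $l^p(G)^k$ via $\varphi\mapsto(\varphi(x_j))_j$; the topologies do not depend on the choice. With $\tilde\partial_i(\varphi)=\varphi\circ\partial_i$,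 and with $\partial_0\otimes 1=0$ and $\tilde\partial_0=0$, the reduced $l^p$-homology and $l^p$-cohomology of $G$ are $$\overline{H^{(p)}_i(G)}=\ker(\partial_i\otimes 1)\big/\overline{\mathrm{im}(\partial_{i+1}\otimes 1)},\qquad \overline{H_{(p)}^i(G)}=\ker(\tilde\partial_{i+1})\big/\overline{\mathrm{im}(\tilde\partial_i)} .$$ If the center $Z(G)$ is infinite, then $\overline{H^{(p)}_i(G)}=0$ and $\overline{H_{(p)}^i(G)}=0$ for all $0\le i\le n$, whichever such resolution $F$ is used to compute them. -/

import Mathlib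

open CategoryTheory
open scoped ENNReal TensorProduct

universe u

noncomputable section

namespace LpHom

/-! ### The Banach space `ℓᵖ(G)` as a module over the integral group ring -/

/-- `ℓᵖ(G)`: complex valued functions on `G` with finite `p`-norm. -/
abbrev LpG (G : Type u) (p : ℝ≥0∞) : Type u := lp (fun _ : G => ℂ) p

theorem memlp_translate {G : Type u} [Group G] {p : ℝ≥0∞} (g : G) {f : G → ℂ}
    (hf : Memℓp f p) : Memℓp (fun h => f (g⁻¹ * h)) p := by
  rcases p.trichotomy with rfl | rfl | hp
  · rw [memℓp_zero_iff] at hf ⊢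
    exact hf.preimage (mul_right_injective g⁻¹).injOn
  · rw [memℓp_infty_iff] at hf ⊢
    refine hf.mono ?_
    rintro _ ⟨h, rfl⟩
    exact ⟨g⁻¹ * h, rfl⟩
  · rw [memℓp_gen_iff hp] at hf ⊢
    exact hf.comp_injective (mul_right_injective g⁻¹)

/-- Left translation `(g f)(h) = f (g⁻¹ h)`, i.e. `g · ∑ f_h h = ∑ f_h gh`. -/
def translation (G : Type u) [Group G] (p : ℝ≥0∞) : G →* AddMonoid.End (LpG G p) where
  toFun g :=
    { toFun := fun f => ⟨fun h => f (g⁻¹ * h), memlp_translate g f.2⟩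
      map_zero' := rfl
      map_add' := fun _ _ => rfl }
  map_one' := by
    ext f h
    simp only [inv_one, one_mul]
    rfl
  map_mul' a b := by
    ext f h
    simp only [mul_inv_rev, mul_assoc]
    rfl

/-- `ℓᵖ(G)` as a left `ℤ[G]`-module: the `ℤ`-linear extension of left translation. -/
instance instModuleLpG (G : Type u) [Group G] (p : ℝ≥0∞) :
    Module (MonoidAlgebra ℤ G) (LpG G p) :=
  Module.compHom (LpG G p)
    (MonoidAlgebra.lift ℤ (AddMonoid.End (LpG G p)) G (translation G p)).toRingHom

theorem single_smul_apply {G : Type u} [Group G] {p : ℝ≥0∞} (g h : G) (f : LpG G p) :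
    (MonoidAlgebra.single g (1 : ℤ) • f : LpG G p) h = f (g⁻¹ * h) := by
  change ((MonoidAlgebra.lift ℤ (AddMonoid.End (LpG G p)) G (translation G p)
    (MonoidAlgebra.single g (1 : ℤ))) f) h = _
  rw [MonoidAlgebra.lift_single, one_smul]
  rfl

/-! ### The functor `M ↦ M ⊗_{ℤ[G]} ℓᵖ(G)` -/

section Tensor

variable {G : Type u} [Group G] (M N : Type u) [AddCommGroup M] [Module (MonoidAlgebra ℤ G) M]
  [AddCommGroup N] [Module (MonoidAlgebra ℤ G) N]
  (p : ℝ≥0∞)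

/-- The relations `gm ⊗ gf = m ⊗ f` in `M ⊗_ℤ ℓᵖ(G)`. -/
def tensorRel : Submodule ℤ (M ⊗[ℤ] LpG G p) :=
  Submodule.span ℤ {z | ∃ (g : G) (m : M) (f : LpG G p),
    z = ((MonoidAlgebra.single g (1 : ℤ) • m) ⊗ₜ[ℤ] (MonoidAlgebra.single g (1 : ℤ) • f) :
      M ⊗[ℤ] LpG G p) - m ⊗ₜ[ℤ] f}

/-- `M ⊗_{ℤ[G]} ℓᵖ(G)`, where the left module `M` is regarded as a right module through
`m g = g⁻¹ m`: the quotient of `M ⊗_ℤ ℓᵖ(G)` by the relations `gm ⊗ gf = m ⊗ f`. -/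
def TensorLp : Type u := (M ⊗[ℤ] LpG G p) ⧸ tensorRel (G := G) M p

instance : AddCommGroup (TensorLp (G := G) M p) :=
  inferInstanceAs (AddCommGroup ((M ⊗[ℤ] LpG G p) ⧸ tensorRel (G := G) M p))

variable {M N}

/-- The class of the elementary tensor `m ⊗ f`. -/
def TensorLp.tmul (m : M) (f : LpG G p) : TensorLp (G := G) M p :=
  (tensorRel (G := G) M p).mkQ (m ⊗ₜ[ℤ] f)

variable (M) in
/-- The natural topology of `M ⊗_{ℤ[G]} ℓᵖ(G)`: the finest group topology for which
`f ↦ m ⊗ f` is continuous on the Banach space `ℓᵖ(G)` for every `m`. If `m₁, …, m_k` generate `M`,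
this is the quotient topology of
`ℓᵖ(G)ᵏ → M ⊗_{ℤ[G]} ℓᵖ(G)`, `(f_j) ↦ ∑ m_j ⊗ f_j`; for `M` finitely generated and projective
it is the topology of `M ⊗_{ℤ[G]} ℓᵖ(G)` as a direct summand of `ℓᵖ(G)ᵏ`. -/
def tensorTopology [Fact (1 ≤ p)] : AddGroupTopology (TensorLp (G := G) M p) :=
  sInf {t | ∀ m : M, @Continuous _ _ _ t.toTopologicalSpace
    (fun f : LpG G p => TensorLp.tmul (G := G) p m f)}

instance [Fact (1 ≤ p)] : TopologicalSpace (TensorLp (G := G) M p) :=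
  (tensorTopology (G := G) M p).toTopologicalSpace

instance [Fact (1 ≤ p)] : IsTopologicalAddGroup (TensorLp (G := G) M p) :=
  (tensorTopology (G := G) M p).toIsTopologicalAddGroup

theorem tensorRel_le_comap (φ : M →ₗ[MonoidAlgebra ℤ G] N) :
    tensorRel (G := G) M p ≤
      (tensorRel (G := G) N p).comap (φ.toAddMonoidHom.toIntLinearMap.rTensor (LpG G p)) := by
  refine Submodule.span_le.2 ?_
  rintro _ ⟨g, m, f, rfl⟩
  refine Submodule.subset_span ⟨g, φ m, f, ?_⟩
  simp

/-- The map `φ ⊗ 1`. -/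
def tensorMap (φ : M →ₗ[MonoidAlgebra ℤ G] N) :
    TensorLp (G := G) M p →+ TensorLp (G := G) N p :=
  ((tensorRel (G := G) M p).mapQ (tensorRel (G := G) N p)
    (φ.toAddMonoidHom.toIntLinearMap.rTensor (LpG G p))
    (tensorRel_le_comap p φ)).toAddMonoidHom

end Tensor

/-! ### The functor `M ↦ Hom_{ℤ[G]}(M, ℓᵖ(G))` -/

section Hom

variable {G : Type u} [Group G] (M N : Type u) [AddCommGroup M] [Module (MonoidAlgebra ℤ G) M]
  [AddCommGroup N] [Module (MonoidAlgebra ℤ G) N] (p : ℝ≥0∞)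

/-- `Hom_{ℤ[G]}(M, ℓᵖ(G))`. -/
def HomLp : Type u := M →ₗ[MonoidAlgebra ℤ G] LpG G p

instance : AddCommGroup (HomLp (G := G) M p) :=
  inferInstanceAs (AddCommGroup (M →ₗ[MonoidAlgebra ℤ G] LpG G p))

/-- Evaluation, as an additive map into the functions `M → ℓᵖ(G)`. -/
def HomLp.eval : HomLp (G := G) M p →+ (M → LpG G p) where
  toFun φ m := (show M →ₗ[MonoidAlgebra ℤ G] LpG G p from φ) m
  map_zero' := rfl
  map_add' _ _ := rfl

/-- The natural topology of `Hom_{ℤ[G]}(M, ℓᵖ(G))`: pointwise convergence in the norm of `ℓᵖ(G)`.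
If `m₁, …, m_k` generate `M`, this is the topology of the norm of `ℓᵖ(G)ᵏ` restricted along
`φ ↦ (φ m₁, …, φ m_k)`. -/
instance [Fact (1 ≤ p)] : TopologicalSpace (HomLp (G := G) M p) :=
  TopologicalSpace.induced (HomLp.eval (G := G) M p) inferInstance

instance [Fact (1 ≤ p)] : IsTopologicalAddGroup (HomLp (G := G) M p) :=
  topologicalAddGroup_induced (HomLp.eval (G := G) M p)

variable {M N}

/-- The dual map `ψ ↦ ψ ∘ φ`. -/
def homMap (φ : M →ₗ[MonoidAlgebra ℤ G] N) : HomLp (G := G) N p →+ HomLp (G := G) M p where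
  toFun ψ := (show N →ₗ[MonoidAlgebra ℤ G] LpG G p from ψ).comp φ
  map_zero' := rfl
  map_add' _ _ := rfl

end Hom

/-! ### Resolutions, groups of type `FP_n`, reduced `ℓᵖ`-homology and `ℓᵖ`-cohomology -/

section Resolution

variable (G : Type u) [Group G]

/-- The `ℤ[G]`-module `ℤ` with trivial `G`-action. -/
abbrev trivialModule : ModuleCat.{u} (MonoidAlgebra ℤ G) :=
  ModuleCat.of (MonoidAlgebra ℤ G) (Representation.trivial ℤ G (ULift.{u} ℤ)).asModule

variable {G} in
/-- The modules `F_0, …, F_n` of the resolution `… → F_1 → F_0 → ℤ → 0` are finitely generated. -/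
def FiniteTypeUpTo (F : ProjectiveResolution (trivialModule G)) (n : ℕ) : Prop :=
  ∀ i ≤ n, Module.Finite (MonoidAlgebra ℤ G) (F.complex.X i)

/-- `G` is of type `FP_n`: the trivial `ℤ[G]`-module `ℤ` has a projective resolution `F` with
`F_0, …, F_n` finitely generated. -/
def IsTypeFP (n : ℕ) : Prop :=
  ∃ F : ProjectiveResolution (trivialModule G), FiniteTypeUpTo F n

variable {G} (F : ProjectiveResolution (trivialModule G)) (p : ℝ≥0∞)

/-- The map `F_i ⊗_{ℤ[G]} ℓᵖ(G) → F_j ⊗_{ℤ[G]} ℓᵖ(G)` given by the differential `F_i → F_j`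
(which is `0` unless `j + 1 = i`). -/
def tensorD (i j : ℕ) :
    TensorLp (G := G) (F.complex.X i) p →+ TensorLp (G := G) (F.complex.X j) p :=
  tensorMap p (F.complex.d i j).hom

/-- The map `Hom_{ℤ[G]}(F_j, ℓᵖ(G)) → Hom_{ℤ[G]}(F_i, ℓᵖ(G))` given by the differential
`F_i → F_j` (which is `0` unless `j + 1 = i`). -/
def homD (i j : ℕ) :
    HomLp (G := G) (F.complex.X j) p →+ HomLp (G := G) (F.complex.X i) p :=
  homMap p (F.complex.d i j).hom

/-- The `i`-cycles of `F ⊗_{ℤ[G]} ℓᵖ(G)`; for `i = 0` the differential `d 0 0` is zero, so every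
chain is a cycle. -/
def cycles (i : ℕ) : AddSubgroup (TensorLp (G := G) (F.complex.X i) p) :=
  (tensorD F p i (i - 1)).ker

/-- The `i`-boundaries of `F ⊗_{ℤ[G]} ℓᵖ(G)`. -/
def boundaries (i : ℕ) : AddSubgroup (TensorLp (G := G) (F.complex.X i) p) :=
  (tensorD F p (i + 1) i).range

/-- The `i`-cocycles of `Hom_{ℤ[G]}(F, ℓᵖ(G))`. -/
def cocycles (i : ℕ) : AddSubgroup (HomLp (G := G) (F.complex.X i) p) :=
  (homD F p (i + 1) i).ker

/-- The `i`-coboundaries of `Hom_{ℤ[G]}(F, ℓᵖ(G))`; for `i = 0` the differential `d 0 0` is zero,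
so only `0` is a coboundary. -/
def coboundaries (i : ℕ) : AddSubgroup (HomLp (G := G) (F.complex.X i) p) :=
  (homD F p i (i - 1)).range

/-- Reduced `ℓᵖ`-homology: cycles modulo the closure of the boundaries. -/
abbrev ReducedLpHomology [Fact (1 ≤ p)] (i : ℕ) : Type u :=
  cycles F p i ⧸ (boundaries F p i).topologicalClosure.addSubgroupOf (cycles F p i)

/-- Reduced `ℓᵖ`-cohomology: cocycles modulo the closure of the coboundaries. -/
abbrev ReducedLpCohomology [Fact (1 ≤ p)] (i : ℕ) : Type u :=
  cocycles F p i ⧸ (coboundaries F p i).topologicalClosure.addSubgroupOf (cocycles F p i)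

end Resolution

end LpHom

end

/-!
The centre kills reduced `ℓᵖ`-(co)homology for the following reason. For `z` central, multiplication
by `z` is an endomorphism of the resolution `F` lifting the identity of the trivial module, hence it
is chain homotopic to the identity (`centralHomotopy`). So for a (co)cycle `x` the difference
`x - z x` is a (co)boundary (`tensorMap_centralSMul_sub_mem_boundaries`,
`homMap_centralSMul_sub_mem_coboundaries`), and the action of `z` through `F` can be traded for an
action through the coefficients `ℓᵖ(G)` (`tensorCoeff_centralSMul`, `homCoeff_centralSMul`).

Take an injective sequence `z₀, z₁, …` of central elements, and let `A_N` be the mean of the first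
`N + 1` of the corresponding translations of `ℓᵖ(G)`. Then `x - A_N x` is a (co)boundary. On the other
hand `A_N f → 0` in norm for every `f` (`tendsto_average`): for a point mass the norm of `A_N f` is
a multiple of `(N + 1) ^ (1 / p - 1)`, which tends to `0` because `1 < p`; point masses span a dense
subspace because `p < ∞`; and the `A_N` are contractions. Both natural topologies make
`A_N x → 0`, so `x` is a limit of (co)boundaries.
-/

open Filter Topology

namespace LpHom

/-! ### Central elements and scalars as module endomorphisms -/

section Endomorphisms

variable {G : Type u} [Group G]

theorem single_center_commute (z : Subgroup.center G) (r : MonoidAlgebra ℤ G) :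
    Commute (MonoidAlgebra.single (z : G) (1 : ℤ)) r :=
  MonoidAlgebra.single_commute (fun g => (Subgroup.mem_center_iff.1 z.2 g).symm)
    (fun n => Commute.one_left n) r

/-- Multiplication by a central element of `G`, as an endomorphism of a `ℤ[G]`-module. -/
noncomputable def centralSMul (M : Type u) [AddCommGroup M] [Module (MonoidAlgebra ℤ G) M]
    (z : Subgroup.center G) : M →ₗ[MonoidAlgebra ℤ G] M where
  toFun m := MonoidAlgebra.single (z : G) (1 : ℤ) • m
  map_add' := smul_add _
  map_smul' r m := by
    rw [RingHom.id_apply, smul_smul, smul_smul, (single_center_commute z r).eq]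

theorem centralSMul_apply {M : Type u} [AddCommGroup M] [Module (MonoidAlgebra ℤ G) M]
    (z : Subgroup.center G) (m : M) :
    centralSMul M z m = MonoidAlgebra.single (z : G) (1 : ℤ) • m := rfl

theorem smul_smul_comm_complex {p : ℝ≥0∞} (r : MonoidAlgebra ℤ G) (c : ℂ) (f : LpG G p) :
    r • c • f = c • r • f := by
  induction r using MonoidAlgebra.induction_linear with
  | zero => simp only [zero_smul, smul_zero]
  | add a b ha hb => rw [add_smul, add_smul, smul_add, ha, hb]
  | single g n =>
    have h : MonoidAlgebra.single g n = n • MonoidAlgebra.single g (1 : ℤ) := by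
      rw [MonoidAlgebra.smul_single, smul_eq_mul, mul_one]
    rw [h, smul_assoc, smul_assoc, smul_comm c n]
    congr 1
    ext k
    simp only [single_smul_apply, lp.coeFn_smul, Pi.smul_apply]

/-- Multiplication by a complex number, as a `ℤ[G]`-linear endomorphism of `ℓᵖ(G)`. -/
noncomputable def scalarEnd (G : Type u) [Group G] (p : ℝ≥0∞) (c : ℂ) :
    LpG G p →ₗ[MonoidAlgebra ℤ G] LpG G p where
  toFun f := c • f
  map_add' := smul_add c
  map_smul' r f := (smul_smul_comm_complex r c f).symm

/-- The mean of the translations of `ℓᵖ(G)` by the first `N + 1` members of a sequence of central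
elements. -/
noncomputable def average (p : ℝ≥0∞) (z : ℕ → Subgroup.center G) (N : ℕ) :
    LpG G p →ₗ[MonoidAlgebra ℤ G] LpG G p :=
  scalarEnd G p ((N : ℂ) + 1)⁻¹ ∘ₗ ∑ j ∈ Finset.range (N + 1), centralSMul (LpG G p) (z j)

theorem average_apply (p : ℝ≥0∞) (z : ℕ → Subgroup.center G) (N : ℕ) (f : LpG G p) :
    average p z N f =
      ((N : ℂ) + 1)⁻¹ • ∑ j ∈ Finset.range (N + 1), centralSMul (LpG G p) (z j) f := by
  simp [average, scalarEnd]

/-- `1 - A_N` is a scalar multiple of a sum of operators `1 - z`, each of which sends (co)cycles to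
(co)boundaries. -/
theorem id_sub_average (p : ℝ≥0∞) (z : ℕ → Subgroup.center G) (N : ℕ) :
    LinearMap.id - average p z N = scalarEnd G p ((N : ℂ) + 1)⁻¹ ∘ₗ
      ∑ j ∈ Finset.range (N + 1), (LinearMap.id - centralSMul (LpG G p) (z j)) := by
  refine LinearMap.ext fun f => ?_
  have hN : ((N : ℂ) + 1) ≠ 0 := Nat.cast_add_one_ne_zero N
  have h : f = ((N : ℂ) + 1)⁻¹ • ∑ _j ∈ Finset.range (N + 1), f := by
    rw [Finset.sum_const, Finset.card_range, ← Nat.cast_smul_eq_nsmul ℂ, smul_smul, Nat.cast_add,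
      Nat.cast_one, inv_mul_cancel₀ hN, one_smul]
  rw [LinearMap.sub_apply, average_apply, LinearMap.id_apply]
  conv_lhs => rw [h, ← h]
  simp only [LinearMap.comp_apply, scalarEnd, LinearMap.coe_mk, AddHom.coe_mk,
    LinearMap.sum_apply, LinearMap.sub_apply, LinearMap.id_apply, Finset.sum_sub_distrib,
    smul_sub, ← h]

end Endomorphisms

/-! ### Averages of translations tend strongly to zero -/

section Averages

variable {G : Type u} [Group G] {p : ℝ≥0∞}

theorem norm_centralSMul [Fact (1 ≤ p)] (hp' : p < ∞) (z : Subgroup.center G) (f : LpG G p) :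
    ‖centralSMul (LpG G p) z f‖ = ‖f‖ := by
  have h0 : 0 < p.toReal :=
    ENNReal.toReal_pos (zero_lt_one.trans_le (Fact.out : 1 ≤ p)).ne' hp'.ne
  rw [lp.norm_eq_tsum_rpow h0, lp.norm_eq_tsum_rpow h0]
  congr 1
  simp only [centralSMul_apply, single_smul_apply]
  exact (Equiv.mulLeft (z : G)⁻¹).tsum_eq fun g => ‖f g‖ ^ p.toReal

theorem norm_average_le [Fact (1 ≤ p)] (hp' : p < ∞) (z : ℕ → Subgroup.center G) (N : ℕ)
    (f : LpG G p) : ‖average p z N f‖ ≤ ‖f‖ := by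
  have hN : (0 : ℝ) < (N : ℝ) + 1 := Nat.cast_add_one_pos N
  have hc : ‖((N : ℂ) + 1)⁻¹‖ = ((N : ℝ) + 1)⁻¹ := by
    rw [norm_inv]
    exact_mod_cast congrArg _ (Complex.norm_natCast (N + 1))
  rw [average_apply, norm_smul, hc]
  have h := norm_sum_le (Finset.range (N + 1)) fun j => centralSMul (LpG G p) (z j) f
  simp only [norm_centralSMul hp', Finset.sum_const, Finset.card_range, nsmul_eq_mul] at h
  rw [inv_mul_le_iff₀ hN]
  exact_mod_cast h

variable [DecidableEq G]

theorem centralSMul_single (z : Subgroup.center G) (g : G) (a : ℂ) :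
    centralSMul (LpG G p) z (lp.single p g a) = lp.single p ((z : G) * g) a := by
  ext h
  rw [centralSMul_apply, single_smul_apply, lp.single_apply, lp.single_apply]
  simp only [Pi.single_apply, inv_mul_eq_iff_eq_mul]

/-- The translates of a point mass have disjoint supports, so the norm of their mean is a power of
`N + 1`. -/
theorem norm_average_single [Fact (1 ≤ p)] (hp' : p < ∞) {z : ℕ → Subgroup.center G}
    (hz : Function.Injective z) (N : ℕ) (g : G) (a : ℂ) :
    ‖average p z N (lp.single p g a)‖ = ((N : ℝ) + 1) ^ (-(1 - p.toReal⁻¹)) * ‖a‖ := by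
  have h0 : 0 < p.toReal :=
    ENNReal.toReal_pos (zero_lt_one.trans_le (Fact.out : 1 ≤ p)).ne' hp'.ne
  have hN : (0 : ℝ) < (N : ℝ) + 1 := Nat.cast_add_one_pos N
  have hc : ‖((N : ℂ) + 1)⁻¹‖ = ((N : ℝ) + 1)⁻¹ := by
    rw [norm_inv]
    exact_mod_cast congrArg _ (Complex.norm_natCast (N + 1))
  have hinj : Function.Injective fun j => (z j : G) * g := fun i j hij =>
    hz (Subtype.ext (mul_right_cancel hij))
  have hs : ∑ j ∈ Finset.range (N + 1), centralSMul (LpG G p) (z j) (lp.single p g a) =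
      ∑ k ∈ (Finset.range (N + 1)).image fun j => (z j : G) * g, lp.single p k a := by
    rw [Finset.sum_image fun i _ j _ hij => hinj hij]
    exact Finset.sum_congr rfl fun j _ => centralSMul_single (z j) g a
  have hn : ‖∑ k ∈ (Finset.range (N + 1)).image (fun j => (z j : G) * g),
      (lp.single p k a : LpG G p)‖ ^ p.toReal = ((N : ℝ) + 1) * ‖a‖ ^ p.toReal := by
    rw [lp.norm_sum_single h0 (fun _ => a), Finset.sum_const,
      Finset.card_image_of_injective _ hinj, Finset.card_range, nsmul_eq_mul, Nat.cast_add_one]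
  rw [average_apply, norm_smul, hc, hs, ← Real.rpow_rpow_inv (norm_nonneg (∑ k ∈ _, _)) h0.ne',
    hn, Real.mul_rpow hN.le (by positivity), Real.rpow_rpow_inv (norm_nonneg a) h0.ne',
    ← mul_assoc, neg_sub, Real.rpow_sub_one hN.ne', div_eq_inv_mul]

/-- For `1 < p < ∞` the means of infinitely many distinct central translations tend strongly to
zero on `ℓᵖ(G)`. -/
theorem tendsto_average [Fact (1 ≤ p)] (hp : 1 < p) (hp' : p < ∞) {z : ℕ → Subgroup.center G}
    (hz : Function.Injective z) (f : LpG G p) :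
    Tendsto (fun N => average p z N f) atTop (𝓝 0) := by
  have hp1 : 1 < p.toReal := by
    rwa [← ENNReal.toReal_one, ENNReal.toReal_lt_toReal ENNReal.one_ne_top hp'.ne]
  have hsingle (g : G) (a : ℂ) :
      Tendsto (fun N => average p z N (lp.single p g a)) atTop (𝓝 0) := by
    rw [tendsto_zero_iff_norm_tendsto_zero]
    simp only [norm_average_single hp' hz]
    have h := (tendsto_rpow_neg_atTop (sub_pos.2 (inv_lt_one_of_one_lt₀ hp1))).comp
      (tendsto_atTop_add_const_right atTop (1 : ℝ) tendsto_natCast_atTop_atTop)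
    simpa using h.mul_const ‖a‖
  have hfin (s : Finset G) :
      Tendsto (fun N => average p z N (∑ g ∈ s, lp.single p g (f g))) atTop (𝓝 0) := by
    simp only [map_sum]
    simpa using tendsto_finsetSum s fun g _ => hsingle g (f g)
  -- Approximate `f` by finite sums of point masses; the contractions `A_N` preserve the error bound.
  rw [Metric.tendsto_nhds]
  intro ε hε
  obtain ⟨s, hs⟩ := ((Metric.tendsto_nhds.1 (lp.hasSum_single hp'.ne f)) (ε / 2)
    (half_pos hε)).exists
  filter_upwards [(Metric.tendsto_nhds.1 (hfin s)) (ε / 2) (half_pos hε)] with N hN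
  rw [dist_zero_right] at hN ⊢
  rw [dist_comm, dist_eq_norm] at hs
  have h1 := (norm_average_le hp' z N (f - ∑ g ∈ s, lp.single p g (f g))).trans_lt hs
  rw [map_sub] at h1
  have h2 := norm_add_le (average p z N f - average p z N (∑ g ∈ s, lp.single p g (f g)))
    (average p z N (∑ g ∈ s, lp.single p g (f g)))
  rw [sub_add_cancel] at h2
  linarith

end Averages

/-! ### Endomorphisms of the coefficients -/

section Coefficients

variable {G : Type u} [Group G] {M N : Type u} [AddCommGroup M] [Module (MonoidAlgebra ℤ G) M]
  [AddCommGroup N] [Module (MonoidAlgebra ℤ G) N] {p : ℝ≥0∞}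

theorem TensorLp.induction {P : TensorLp (G := G) M p → Prop} (zero : P 0)
    (tmul : ∀ m f, P (TensorLp.tmul p m f)) (add : ∀ x y, P x → P y → P (x + y))
    (x : TensorLp (G := G) M p) : P x := by
  obtain ⟨t, rfl⟩ := (tensorRel (G := G) M p).mkQ_surjective x
  induction t using TensorProduct.induction_on with
  | zero => exact zero
  | tmul m f => exact tmul m f
  | add a b ha hb => exact add _ _ ha hb

theorem TensorLp.hom_ext {A : Type*} [AddCommGroup A] {a b : TensorLp (G := G) M p →+ A}
    (h : ∀ m f, a (TensorLp.tmul p m f) = b (TensorLp.tmul p m f)) : a = b :=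
  AddMonoidHom.ext fun x => TensorLp.induction (P := fun x => a x = b x) (by simp) h
    (fun x y hx hy => by rw [map_add, map_add, hx, hy]) x

theorem TensorLp.tmul_add (m : M) (f f' : LpG G p) :
    TensorLp.tmul p m (f + f') = TensorLp.tmul p m f + TensorLp.tmul p m f' := by
  unfold TensorLp.tmul
  rw [TensorProduct.tmul_add]
  exact map_add (tensorRel (G := G) M p).mkQ _ _

theorem TensorLp.add_tmul (m m' : M) (f : LpG G p) :
    TensorLp.tmul p (m + m') f = TensorLp.tmul p m f + TensorLp.tmul p m' f := by
  unfold TensorLp.tmul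
  rw [TensorProduct.add_tmul]
  exact map_add (tensorRel (G := G) M p).mkQ _ _

theorem TensorLp.tmul_zero (m : M) : TensorLp.tmul p m (0 : LpG G p) = 0 := by
  have h := TensorLp.tmul_add m (0 : LpG G p) 0
  rwa [add_zero, left_eq_add] at h

theorem TensorLp.single_smul_tmul (g : G) (m : M) (f : LpG G p) :
    TensorLp.tmul p (MonoidAlgebra.single g (1 : ℤ) • m) (MonoidAlgebra.single g (1 : ℤ) • f) =
      TensorLp.tmul p m f :=
  (Submodule.Quotient.eq _).2 (Submodule.subset_span ⟨g, m, f, rfl⟩)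

theorem tensorMap_tmul (φ : M →ₗ[MonoidAlgebra ℤ G] N) (m : M) (f : LpG G p) :
    tensorMap p φ (TensorLp.tmul p m f) = TensorLp.tmul p (φ m) f := rfl

theorem tensorMap_add (φ ψ : M →ₗ[MonoidAlgebra ℤ G] N) :
    tensorMap p (φ + ψ) = tensorMap p φ + tensorMap p ψ :=
  TensorLp.hom_ext fun m f => TensorLp.add_tmul (φ m) (ψ m) f

theorem tensorMap_id : tensorMap p (LinearMap.id : M →ₗ[MonoidAlgebra ℤ G] M) = AddMonoidHom.id _ :=
  TensorLp.hom_ext fun _ _ => rfl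

theorem tensorMap_comp {Q : Type u} [AddCommGroup Q] [Module (MonoidAlgebra ℤ G) Q]
    (ψ : N →ₗ[MonoidAlgebra ℤ G] Q) (φ : M →ₗ[MonoidAlgebra ℤ G] N) (x : TensorLp (G := G) M p) :
    tensorMap p (ψ ∘ₗ φ) x = tensorMap p ψ (tensorMap p φ x) :=
  DFunLike.congr_fun (TensorLp.hom_ext (a := tensorMap p (ψ ∘ₗ φ))
    (b := (tensorMap p ψ).comp (tensorMap p φ)) fun _ _ => rfl) x

theorem tensorRel_le_comap_lTensor (L : LpG G p →ₗ[MonoidAlgebra ℤ G] LpG G p) :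
    tensorRel (G := G) M p ≤
      (tensorRel (G := G) M p).comap (L.toAddMonoidHom.toIntLinearMap.lTensor M) := by
  refine Submodule.span_le.2 ?_
  rintro _ ⟨g, m, f, rfl⟩
  refine Submodule.subset_span ⟨g, m, L f, ?_⟩
  simp

variable (M) in
/-- The map `1 ⊗ L` on `M ⊗_{ℤ[G]} ℓᵖ(G)`, for an endomorphism `L` of `ℓᵖ(G)`. -/
noncomputable def tensorCoeff (L : LpG G p →ₗ[MonoidAlgebra ℤ G] LpG G p) :
    TensorLp (G := G) M p →+ TensorLp (G := G) M p :=
  ((tensorRel (G := G) M p).mapQ (tensorRel (G := G) M p)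
    (L.toAddMonoidHom.toIntLinearMap.lTensor M)
    (tensorRel_le_comap_lTensor L)).toAddMonoidHom

theorem tensorCoeff_tmul (L : LpG G p →ₗ[MonoidAlgebra ℤ G] LpG G p) (m : M) (f : LpG G p) :
    tensorCoeff M L (TensorLp.tmul p m f) = TensorLp.tmul p m (L f) := rfl

theorem tensorCoeff_tensorMap (L : LpG G p →ₗ[MonoidAlgebra ℤ G] LpG G p)
    (φ : M →ₗ[MonoidAlgebra ℤ G] N) (x : TensorLp (G := G) M p) :
    tensorCoeff N L (tensorMap p φ x) = tensorMap p φ (tensorCoeff M L x) :=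
  DFunLike.congr_fun (TensorLp.hom_ext (a := (tensorCoeff N L).comp (tensorMap p φ))
    (b := (tensorMap p φ).comp (tensorCoeff M L)) fun _ _ => rfl) x

variable (M p) in
/-- `L ↦ 1 ⊗ L` as an additive map. -/
noncomputable def tensorCoeffHom : (LpG G p →ₗ[MonoidAlgebra ℤ G] LpG G p) →+
    (TensorLp (G := G) M p →+ TensorLp (G := G) M p) :=
  AddMonoidHom.mk' (tensorCoeff M) fun L L' =>
    TensorLp.hom_ext fun m f => TensorLp.tmul_add m (L f) (L' f)

theorem tensorCoeff_id : tensorCoeff M (LinearMap.id : LpG G p →ₗ[MonoidAlgebra ℤ G] LpG G p) =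
    AddMonoidHom.id _ :=
  TensorLp.hom_ext fun _ _ => rfl

theorem tensorCoeff_comp (L L' : LpG G p →ₗ[MonoidAlgebra ℤ G] LpG G p) :
    tensorCoeff M (L ∘ₗ L') = (tensorCoeff M L).comp (tensorCoeff M L') :=
  TensorLp.hom_ext fun _ _ => rfl

/-- The inverse appears because `M` is a right module through `m g = g⁻¹ m`. -/
theorem tensorCoeff_centralSMul (z : Subgroup.center G) :
    tensorCoeff M (centralSMul (LpG G p) z) = tensorMap p (centralSMul M z⁻¹) := by
  refine TensorLp.hom_ext fun m f => ?_
  rw [tensorCoeff_tmul, tensorMap_tmul, ← TensorLp.single_smul_tmul (z : G) (centralSMul M z⁻¹ m)]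
  rw [centralSMul_apply, centralSMul_apply, smul_smul, MonoidAlgebra.single_mul_single]
  simp [← MonoidAlgebra.one_def]

/-- The natural topology is an infimum of group topologies for which this map is continuous, and
continuity passes to infima of topologies on the target. -/
theorem continuous_tmul [Fact (1 ≤ p)] (m : M) :
    Continuous fun f : LpG G p => TensorLp.tmul (G := G) p m f := by
  change @Continuous _ _ _ (tensorTopology (G := G) M p).toTopologicalSpace _
  rw [tensorTopology, AddGroupTopology.toTopologicalSpace_sInf, continuous_sInf_rng]
  rintro _ ⟨t, ht, rfl⟩
  exact ht m

theorem tendsto_tensorCoeff [Fact (1 ≤ p)] {L : ℕ → LpG G p →ₗ[MonoidAlgebra ℤ G] LpG G p}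
    (hL : ∀ f, Tendsto (fun k => L k f) atTop (𝓝 0)) (x : TensorLp (G := G) M p) :
    Tendsto (fun k => tensorCoeff M (L k) x) atTop (𝓝 0) := by
  induction x using TensorLp.induction with
  | zero => simpa only [map_zero] using tendsto_const_nhds
  | tmul m f =>
    have h := ((continuous_tmul (p := p) m).tendsto 0).comp (hL f)
    rw [TensorLp.tmul_zero] at h
    exact h
  | add x y hx hy => simpa only [map_add, add_zero] using hx.add hy

variable (M) in
/-- Composition with an endomorphism `L` of `ℓᵖ(G)` on `Hom_{ℤ[G]}(M, ℓᵖ(G))`. -/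
noncomputable def homCoeff (L : LpG G p →ₗ[MonoidAlgebra ℤ G] LpG G p) :
    HomLp (G := G) M p →+ HomLp (G := G) M p where
  toFun ψ := L.comp (show M →ₗ[MonoidAlgebra ℤ G] LpG G p from ψ)
  map_zero' := LinearMap.comp_zero L
  map_add' ψ ψ' := LinearMap.comp_add
    (show M →ₗ[MonoidAlgebra ℤ G] LpG G p from ψ) (show M →ₗ[MonoidAlgebra ℤ G] LpG G p from ψ') L

/-- Extensionality for `HomLp`, phrased through `HomLp.eval` because `HomLp` carries no coercion to
functions. -/
theorem HomLp.ext {φ ψ : HomLp (G := G) M p}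
    (h : ∀ m, HomLp.eval M p φ m = HomLp.eval M p ψ m) : φ = ψ :=
  LinearMap.ext h

variable (M p) in
/-- `L ↦ (ψ ↦ L ∘ ψ)` as an additive map. -/
noncomputable def homCoeffHom : (LpG G p →ₗ[MonoidAlgebra ℤ G] LpG G p) →+
    (HomLp (G := G) M p →+ HomLp (G := G) M p) :=
  AddMonoidHom.mk' (homCoeff M) fun L L' => AddMonoidHom.ext fun ψ =>
    LinearMap.add_comp (show M →ₗ[MonoidAlgebra ℤ G] LpG G p from ψ) L' L

theorem homCoeff_homMap (L : LpG G p →ₗ[MonoidAlgebra ℤ G] LpG G p)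
    (φ : M →ₗ[MonoidAlgebra ℤ G] N) (ψ : HomLp (G := G) N p) :
    homCoeff M L (homMap p φ ψ) = homMap p φ (homCoeff N L ψ) := rfl

theorem homCoeff_comp (L L' : LpG G p →ₗ[MonoidAlgebra ℤ G] LpG G p) :
    homCoeff M (L ∘ₗ L') = (homCoeff M L).comp (homCoeff M L') := rfl

theorem homCoeff_centralSMul (z : Subgroup.center G) :
    homCoeff M (centralSMul (LpG G p) z) = homMap p (centralSMul M z) :=
  AddMonoidHom.ext fun ψ => HomLp.ext fun m =>
    (LinearMap.map_smul (show M →ₗ[MonoidAlgebra ℤ G] LpG G p from ψ)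
      (MonoidAlgebra.single (z : G) (1 : ℤ)) m).symm

theorem tendsto_homCoeff [Fact (1 ≤ p)] {L : ℕ → LpG G p →ₗ[MonoidAlgebra ℤ G] LpG G p}
    (hL : ∀ f, Tendsto (fun k => L k f) atTop (𝓝 0)) (ψ : HomLp (G := G) M p) :
    Tendsto (fun k => homCoeff M (L k) ψ) atTop (𝓝 0) := by
  rw [(Topology.IsInducing.mk rfl : Topology.IsInducing (HomLp.eval (G := G) M p)).tendsto_nhds_iff,
    map_zero, tendsto_pi_nhds]
  exact fun m => hL (HomLp.eval M p ψ m)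

end Coefficients

/-! ### Central elements act homotopically trivially on a resolution -/

section Homotopy

variable {G : Type u} [Group G] (F : ProjectiveResolution (trivialModule G)) {p : ℝ≥0∞}

/-- Multiplication by a central element, as a chain endomorphism. -/
noncomputable def centralChainMap (z : Subgroup.center G) : F.complex ⟶ F.complex where
  f i := ModuleCat.ofHom (centralSMul (F.complex.X i) z)
  comm' i j _ := by
    ext m
    exact LinearMap.map_smul (F.complex.d i j).hom (MonoidAlgebra.single (z : G) (1 : ℤ)) m

theorem single_center_smul_trivialModule (z : Subgroup.center G) (m : trivialModule G) :
    MonoidAlgebra.single (z : G) (1 : ℤ) • m = m := by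
  refine (Representation.asModuleEquiv (Representation.trivial ℤ G (ULift.{u} ℤ))).injective ?_
  refine (Representation.asModuleEquiv_map_smul _ _ _).trans ?_
  simp

/-- Multiplication by a central element lifts the identity of the trivial module. -/
theorem centralChainMap_π (z : Subgroup.center G) : centralChainMap F z ≫ F.π = F.π := by
  refine HomologicalComplex.to_single_hom_ext ?_
  ext m
  exact (LinearMap.map_smul (ModuleCat.Hom.hom (F.π.f 0))
    (MonoidAlgebra.single (z : G) (1 : ℤ)) m).trans
      (single_center_smul_trivialModule z (ModuleCat.Hom.hom (F.π.f 0) m))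

/-- Multiplication by a central element is homotopic to the identity. -/
noncomputable def centralHomotopy (z : Subgroup.center G) :
    Homotopy (centralChainMap F z) (𝟙 F.complex) :=
  ProjectiveResolution.liftHomotopy (𝟙 _) _ _
    (by rw [centralChainMap_π, CategoryTheory.Functor.map_id, Category.comp_id])
    (by rw [CategoryTheory.Functor.map_id, Category.comp_id, Category.id_comp])

/-- The homotopy formula `z = a ∂ + ∂ b + 1` in degree `i`. For `i = 0` the index `i - 1` is `0`, and
the first term vanishes because the differential `F₀ → F₀` is zero. -/
theorem exists_centralSMul_eq (z : Subgroup.center G) (i : ℕ) :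
    ∃ (a : F.complex.X (i - 1) →ₗ[MonoidAlgebra ℤ G] F.complex.X i)
      (b : F.complex.X i →ₗ[MonoidAlgebra ℤ G] F.complex.X (i + 1)),
      centralSMul (F.complex.X i) z = a ∘ₗ (F.complex.d i (i - 1)).hom +
        (F.complex.d (i + 1) i).hom ∘ₗ b + LinearMap.id := by
  have h := (centralHomotopy F z).comm i
  refine ⟨((centralHomotopy F z).hom (i - 1) i).hom, ((centralHomotopy F z).hom i (i + 1)).hom, ?_⟩
  have hn : dNext i (centralHomotopy F z).hom =
      F.complex.d i (i - 1) ≫ (centralHomotopy F z).hom (i - 1) i := by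
    cases i with
    | zero => simp
    | succ i => exact Homotopy.dNext_succ_chainComplex _ _
  rw [hn, Homotopy.prevD_chainComplex] at h
  exact congrArg ModuleCat.Hom.hom h

theorem tensorMap_centralSMul_sub_mem_boundaries (z : Subgroup.center G) {i : ℕ}
    {x : TensorLp (G := G) (F.complex.X i) p} (hx : x ∈ cycles F p i) :
    x - tensorMap p (centralSMul _ z) x ∈ boundaries F p i := by
  obtain ⟨a, b, h⟩ := exists_centralSMul_eq F z i
  have hx' : tensorMap p (F.complex.d i (i - 1)).hom x = 0 := hx
  refine ⟨-tensorMap p b x, ?_⟩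
  rw [h, tensorMap_add, tensorMap_add, tensorMap_id, AddMonoidHom.add_apply,
    AddMonoidHom.add_apply, tensorMap_comp, tensorMap_comp, hx', map_zero, zero_add, map_neg,
    AddMonoidHom.id_apply, sub_add_cancel_right]
  rfl

theorem homMap_centralSMul_sub_mem_coboundaries (z : Subgroup.center G) {i : ℕ}
    {ψ : HomLp (G := G) (F.complex.X i) p} (hψ : ψ ∈ cocycles F p i) :
    ψ - homMap p (centralSMul _ z) ψ ∈ coboundaries F p i := by
  obtain ⟨a, b, h⟩ := exists_centralSMul_eq F z i
  have hψ' (m) : HomLp.eval _ p ψ ((F.complex.d (i + 1) i).hom m) = 0 :=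
    LinearMap.congr_fun (show (_ : _ →ₗ[MonoidAlgebra ℤ G] LpG G p) = 0 from hψ) m
  refine ⟨-homMap p a ψ, HomLp.ext fun m => ?_⟩
  have hm : HomLp.eval _ p (homMap p (centralSMul (F.complex.X i) z) ψ) m =
      HomLp.eval _ p ψ (a ((F.complex.d i (i - 1)).hom m)) + HomLp.eval _ p ψ m := by
    rw [h]
    change (show _ →ₗ[MonoidAlgebra ℤ G] LpG G p from ψ)
      (a ((F.complex.d i (i - 1)).hom m) + (F.complex.d (i + 1) i).hom (b m) + m) = _
    rw [map_add, map_add]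
    change _ + HomLp.eval _ p ψ ((F.complex.d (i + 1) i).hom (b m)) + _ = _
    rw [hψ', add_zero]
    rfl
  rw [map_neg, map_sub, Pi.sub_apply, hm, sub_add_cancel_right]
  rfl

end Homotopy

/-! ### Vanishing of reduced `ℓᵖ`-homology and `ℓᵖ`-cohomology -/

section Vanishing

variable {G : Type u} [Group G] (F : ProjectiveResolution (trivialModule G)) {p : ℝ≥0∞}
  [Fact (1 ≤ p)]

theorem cycles_le_closure_boundaries (hp : 1 < p) (hp' : p < ∞) {z : ℕ → Subgroup.center G}
    (hz : Function.Injective z) (i : ℕ) :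
    cycles F p i ≤ (boundaries F p i).topologicalClosure := by
  classical
  intro x hx
  have hlim : Tendsto (fun N => x - tensorCoeff _ (average p z N) x) atTop (𝓝 x) := by
    simpa using (tendsto_tensorCoeff (tendsto_average hp hp' hz) x).const_sub x
  refine mem_closure_of_tendsto hlim (Eventually.of_forall fun N => ?_)
  have hsub : x - tensorCoeff _ (average p z N) x =
      tensorCoeffHom _ p (LinearMap.id - average p z N) x := by
    rw [map_sub, AddMonoidHom.sub_apply]
    change _ = tensorCoeff _ LinearMap.id x - _
    rw [tensorCoeff_id]
    rfl
  have hsum : tensorCoeffHom _ p (∑ j ∈ Finset.range (N + 1),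
      (LinearMap.id - centralSMul (LpG G p) (z j))) x ∈ boundaries F p i := by
    rw [map_sum, AddMonoidHom.finsetSum_apply]
    refine sum_mem fun j _ => ?_
    rw [map_sub, AddMonoidHom.sub_apply]
    change tensorCoeff _ LinearMap.id x - tensorCoeff _ (centralSMul _ (z j)) x ∈ _
    rw [tensorCoeff_id, tensorCoeff_centralSMul]
    exact tensorMap_centralSMul_sub_mem_boundaries F (z j)⁻¹ hx
  -- Boundaries are stable under complex scalars, since `∂ ⊗ 1` commutes with `1 ⊗ c`.
  obtain ⟨y, hy⟩ := hsum
  rw [hsub, id_sub_average]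
  refine ⟨tensorCoeff _ (scalarEnd G p ((N : ℂ) + 1)⁻¹) y, ?_⟩
  change tensorMap p _ _ = tensorCoeff _ _ x
  rw [← tensorCoeff_tensorMap, tensorCoeff_comp]
  exact congrArg _ hy

theorem cocycles_le_closure_coboundaries (hp : 1 < p) (hp' : p < ∞) {z : ℕ → Subgroup.center G}
    (hz : Function.Injective z) (i : ℕ) :
    cocycles F p i ≤ (coboundaries F p i).topologicalClosure := by
  classical
  intro ψ hψ
  have hlim : Tendsto (fun N => ψ - homCoeff _ (average p z N) ψ) atTop (𝓝 ψ) := by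
    simpa using (tendsto_homCoeff (tendsto_average hp hp' hz) ψ).const_sub ψ
  refine mem_closure_of_tendsto hlim (Eventually.of_forall fun N => ?_)
  have hsub : ψ - homCoeff _ (average p z N) ψ =
      homCoeffHom _ p (LinearMap.id - average p z N) ψ := by
    rw [map_sub, AddMonoidHom.sub_apply]
    rfl
  have hsum : homCoeffHom _ p (∑ j ∈ Finset.range (N + 1),
      (LinearMap.id - centralSMul (LpG G p) (z j))) ψ ∈ coboundaries F p i := by
    rw [map_sum, AddMonoidHom.finsetSum_apply]
    refine sum_mem fun j _ => ?_
    rw [map_sub, AddMonoidHom.sub_apply]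
    change ψ - homCoeff _ (centralSMul _ (z j)) ψ ∈ _
    rw [homCoeff_centralSMul]
    exact homMap_centralSMul_sub_mem_coboundaries F (z j) hψ
  obtain ⟨y, hy⟩ := hsum
  rw [hsub, id_sub_average]
  refine ⟨homCoeff _ (scalarEnd G p ((N : ℂ) + 1)⁻¹) y, ?_⟩
  change homMap p _ _ = homCoeff _ _ ψ
  rw [← homCoeff_homMap, homCoeff_comp]
  exact congrArg (homCoeff _ _) hy

end Vanishing

end LpHom

theorem mainTheorem1 {G : Type u} [Group G] (p : ℝ≥0∞) [Fact (1 ≤ p)] (hp : 1 < p) (hp' : p < ∞)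
    (n : ℕ) (hG : LpHom.IsTypeFP G n) (hZ : Infinite (Subgroup.center G))
    (F : ProjectiveResolution (LpHom.trivialModule G)) (hF : LpHom.FiniteTypeUpTo F n)
    (i : ℕ) (hi : i ≤ n) :
    Subsingleton (LpHom.ReducedLpHomology F p i) ∧
      Subsingleton (LpHom.ReducedLpCohomology F p i) := by
  have hz := (Infinite.natEmbedding (Subgroup.center G)).injective
  constructor
  · unfold LpHom.ReducedLpHomology
    rw [AddSubgroup.addSubgroupOf_eq_top.2 (LpHom.cycles_le_closure_boundaries F hp hp' hz i)]
    exact QuotientAddGroup.subsingleton_quotient_top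
  · unfold LpHom.ReducedLpCohomology
    rw [AddSubgroup.addSubgroupOf_eq_top.2 (LpHom.cocycles_le_closure_coboundaries F hp hp' hz i)]
    exact QuotientAddGroup.subsingleton_quotient_top
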